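/- Let $m\ge 9$ be an integer with $m\equiv 1 \pmod 8$, let $n=2^m-1$, and let $\alpha$ be a generator of $\mathbb{F}_{2^m}^{*}$. For $S\subseteq\mathbb{Z}_8$ put $S'=\mathbb{Z}_8\setminus S$, let $T_S=\{1\le j\le n-1 : w_2(j) \bmod 8\in S\}$, where $w_2(j)$ is the sum of the binary digits of $j$, and let $\mathcal{C}_S$ be the binary cyclic code of length $n$ with generator polynomial $\prod_{j\in T_S}(x-\alpha^j)$. The defining set of a binary cyclic code of length $n$ is the set of $i\in\mathbb{Z}_n$ such that its generator polynomial vanishes at $\alpha^i$. A splitting of $\mathbb{Z}_n$ consists of disjoint sets $S_1,S_2$ with $S_1\cup S_2=\mathbb{Z}_n\setminus\{0\}$, each a union of $2$-cyclotomic cosets modulo $n$, for which there is a unit $\mu\in\mathbb{Z}_n$ with $S_1\mu=S_2$ and $S_2\mu=S_1$. Two binary cyclic codes form a pair of odd-like (respectively even-like) duadic codes if their defining sets are $S_1,S_2$ (respectively $\{0\}\cup S_1,\{0\}\cup S_2$) for some splitting. Write $\mathcal{C}^\perp$ for the dual code and $\overline{\mathcal{C}}=\{(c_0,\dots,c_n)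 : (c_0,\dots,c_{n-1})\in\mathcal{C},\ \sum_{i=0}^n c_i=0\}$ for the extended code. (1) Let $S=\{0,2,3,4\}$ or $S=\{0,4,6,7\}$. Then: (1.1) $\mathcal{C}_S$ and $\mathcal{C}_{S'}$ form a pair of odd-like duadic codes, both with parameters $[2^m-1,\,2^{m-1},\,d]$ with the same $d\ge 2^{(m-1)/2}+3$. (1.2) $\mathcal{C}_S^\perp$ and $\mathcal{C}_{S'}^\perp$ form a pair of even-like duadic codes, both with parameters $[2^m-1,\,2^{m-1}-1,\,d^\perp]$ with the same $d^\perp\ge 2^{(m-1)/2}+4$. (1.3) $\overline{\mathcal{C}_S}$ and $\overline{\mathcal{C}_{S'}}$ both have parameters $[2^m,\,2^{m-1},\,\overline d]$ with the same $\overline d\ge 2^{(m-1)/2}+4$, and they are self-dual and doubly-even. (2) Let $S$ be one of $\{0,2,3,5\}$, $\{0,2,5,6\}$, $\{0,3,5,7\}$, $\{0,5,6,7\}$. Then: (2.1) $\mathcal{C}_S$ and $\mathcal{C}_{S'}$ form a pair of odd-like duadic codes, both with parameters $[2^m-1,\,2^{m-1},\,d]$ with the same $d$, where $d\ge 2^{(m-1)/2}+1$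 if $m\equiv 9\pmod{16}$ and $d\ge 2^{(m-1)/2}+3$ if $m\equiv 1\pmod{16}$. (2.2) $\mathcal{C}_S^\perp$ and $\mathcal{C}_{S'}^\perp$ form a pair of even-like duadic codes, both with parameters $[2^m-1,\,2^{m-1}-1,\,d^\perp]$ with the same $d^\perp$, where $d^\perp\ge 2^{(m-1)/2}+2$ if $m\equiv 9\pmod{16}$ and $d^\perp\ge 2^{(m-1)/2}+4$ if $m\equiv 1\pmod{16}$. (2.3) $\overline{\mathcal{C}_S}$ and $\overline{\mathcal{C}_{S'}}$ both have parameters $[2^m,\,2^{m-1},\,\overline d]$ with the same $\overline d\ge 2^{(m-1)/2}+4$, and they are self-dual and doubly-even. -/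

import Mathlib

open Polynomial

noncomputable section

namespace BinaryCode

/-! ### Binary linear codes of length `n` -/

/-- A binary linear code of length `n`. -/
abbrev Code (n : ℕ) := Submodule (ZMod 2) (Fin n → ZMod 2)

/-- The minimum distance: the least Hamming distance between distinct codewords. (It is `0` for a
code with only one word, so that no positive lower bound holds for such a code.) -/
def minDist {n : ℕ} (C : Code n) : ℕ :=
  sInf {d | ∃ x ∈ C, ∃ y ∈ C, x ≠ y ∧ hammingDist x y = d}

/-- `C` is an `[N, k, d]` code: length `N`, dimension `k`, minimum distance `d`. -/
def HasParameters {n : ℕ} (C : Code n) (N k d : ℕ) : Prop :=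
  n = N ∧ Module.finrank (ZMod 2) C = k ∧ minDist C = d

/-- The dual code with respect to the standard inner product. -/
def dual {n : ℕ} (C : Code n) : Code n where
  carrier := {x | ∀ c ∈ C, x ⬝ᵥ c = 0}
  zero_mem' := by intro c _; exact zero_dotProduct c
  add_mem' := by
    intro x y hx hy c hc
    rw [add_dotProduct, hx c hc, hy c hc, add_zero]
  smul_mem' := by
    intro a x hx c hc
    rw [smul_dotProduct, hx c hc, smul_zero]

/-- The extended code: append one coordinate so that the sum of all coordinates is zero. -/
def extend {n : ℕ} (C : Code n) : Code (n + 1) where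
  carrier := {c | (fun i : Fin n => c i.castSucc) ∈ C ∧ ∑ i, c i = 0}
  zero_mem' := ⟨C.zero_mem, by simp⟩
  add_mem' := by
    intro x y hx hy
    refine ⟨C.add_mem hx.1 hy.1, ?_⟩
    simp only [Pi.add_apply, Finset.sum_add_distrib, hx.2, hy.2, add_zero]
  smul_mem' := by
    intro a x hx
    refine ⟨C.smul_mem a hx.1, ?_⟩
    simp only [Pi.smul_apply, ← Finset.smul_sum, hx.2, smul_zero]

/-- A code is self-dual if it equals its dual. -/
def IsSelfDual {n : ℕ} (C : Code n) : Prop := C = dual C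

/-- A code is doubly-even if all its weights are divisible by four. -/
def IsDoublyEven {n : ℕ} (C : Code n) : Prop := ∀ c ∈ C, 4 ∣ hammingNorm c

/-! ### Cyclic codes -/

/-- The polynomial `c₀ + c₁ x + ⋯ + c_{n-1} x^{n-1}` of a word. -/
def toPoly {n : ℕ} (c : Fin n → ZMod 2) : (ZMod 2)[X] := ∑ i, C (c i) * X ^ (i : ℕ)

/-- `A` is the cyclic code of length `n` with generator polynomial `g`, a monic divisor of
`x ^ n - 1`: its words are those whose polynomial is a multiple of `g`. -/
def HasGeneratorPolynomial {n : ℕ} (A : Code n) (g : (ZMod 2)[X]) : Prop :=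
  g.Monic ∧ g ∣ X ^ n - 1 ∧ ∀ c, c ∈ A ↔ g ∣ toPoly c

section

variable {K : Type*} [Field K] [Algebra (ZMod 2) K]

/-- `A` is a cyclic code whose generator polynomial vanishes at `α ^ i` exactly for `i ∈ T`. -/
def HasDefiningSet {n : ℕ} (α : Kˣ) (A : Code n) (T : Set (ZMod n)) : Prop :=
  ∃ g : (ZMod 2)[X], HasGeneratorPolynomial A g ∧
    T = {i | aeval ((α : K) ^ i.val) g = 0}

/-- The code of length `n` of all binary words whose polynomial is a multiple of `g`. The
polynomial `g` is written over the extension field `K`; if its coefficients lie in `ZMod 2`, being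
a multiple over `K` and being a multiple over `ZMod 2` are the same
(`Polynomial.map_dvd_map'`). -/
def codeOfGenerator (n : ℕ) (g : K[X]) : Code n where
  carrier := {c | g ∣ (toPoly c).map (algebraMap (ZMod 2) K)}
  zero_mem' := by simp [toPoly]
  add_mem' := by
    intro x y hx hy
    have h : toPoly (x + y) = toPoly x + toPoly y := by
      simp [toPoly, add_mul, Finset.sum_add_distrib]
    simp only [Set.mem_ofPred_eq, h, Polynomial.map_add] at *
    exact dvd_add hx hy
  smul_mem' := by
    intro a x hx
    have h : toPoly (a • x) = C a * toPoly x := by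
      simp [toPoly, Finset.mul_sum, mul_assoc]
    simp only [Set.mem_ofPred_eq, h, Polynomial.map_mul] at *
    exact Dvd.dvd.mul_left hx _

/-! ### Duadic codes -/

/-- The `2`-cyclotomic coset of `s` modulo `n`. -/
def cyclotomicCoset {n : ℕ} (s : ZMod n) : Set (ZMod n) := {x | ∃ t : ℕ, x = s * 2 ^ t}

/-- `(S₁, S₂, μ)` is a splitting of `ZMod n`. -/
structure IsSplitting {n : ℕ} (S₁ S₂ : Set (ZMod n)) (μ : (ZMod n)ˣ) : Prop where
  coset_left : ∀ s ∈ S₁, cyclotomicCoset s ⊆ S₁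
  coset_right : ∀ s ∈ S₂, cyclotomicCoset s ⊆ S₂
  union_eq : S₁ ∪ S₂ = {0}ᶜ
  inter_eq : S₁ ∩ S₂ = ∅
  left_mul : (fun s => s * (μ : ZMod n)) '' S₁ = S₂
  right_mul : (fun s => s * (μ : ZMod n)) '' S₂ = S₁

/-- A pair of odd-like duadic codes: cyclic codes whose defining sets form a splitting. -/
def IsOddLikeDuadicPair {n : ℕ} (α : Kˣ) (A₁ A₂ : Code n) : Prop :=
  ∃ (S₁ S₂ : Set (ZMod n)) (μ : (ZMod n)ˣ), IsSplitting S₁ S₂ μ ∧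
    HasDefiningSet α A₁ S₁ ∧ HasDefiningSet α A₂ S₂

/-- A pair of even-like duadic codes: cyclic codes with defining sets `{0} ∪ S₁` and `{0} ∪ S₂`
for a splitting `(S₁, S₂, μ)`. -/
def IsEvenLikeDuadicPair {n : ℕ} (α : Kˣ) (A₁ A₂ : Code n) : Prop :=
  ∃ (S₁ S₂ : Set (ZMod n)) (μ : (ZMod n)ˣ), IsSplitting S₁ S₂ μ ∧
    HasDefiningSet α A₁ ({0} ∪ S₁) ∧ HasDefiningSet α A₂ ({0} ∪ S₂)

/-! ### The codes `C_{[r,m,S]}` -/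

/-- The binary weight of `j`: the sum of its binary digits. -/
def w₂ (j : ℕ) : ℕ := (Nat.digits 2 j).sum

/-- `T_{[r,m,S]} = {1 ≤ j ≤ 2 ^ m - 2 : w₂(j) mod r ∈ S}`. -/
def T (r m : ℕ) (S : Finset (ZMod r)) : Finset ℕ :=
  {j ∈ Finset.Icc 1 (2 ^ m - 2) | (w₂ j : ZMod r) ∈ S}

/-- The polynomial `g_{[r,m,S]}(x) = ∏ (x - α ^ i)` over `i ∈ T_{[r,m,S]}`. -/
def genPoly (r m : ℕ) (α : Kˣ) (S : Finset (ZMod r)) : K[X] :=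
  ∏ i ∈ T r m S, (X - C ((α : K) ^ i))

/-- The binary cyclic code `C_{[r,m,S]}` of length `2 ^ m - 1`. -/
def cyclicCode (r m : ℕ) (α : Kˣ) (S : Finset (ZMod r)) : Code (2 ^ m - 1) :=
  codeOfGenerator (2 ^ m - 1) (genPoly r m α S)

end

end BinaryCode

end

noncomputable section

namespace BinaryCode

section

/-! ### Binary weights -/

/-! Modulo `8`, each of the six sets `S` contains exactly one of `s` and `m - s`. Negating a nonzero
residue modulo `2 ^ m - 1` complements its `m` binary digits and turns weight `w` into `m - w`
(`w₂_val_neg`); doubling rotates the digits and preserves the weight. So the zeros of `C_S` and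
`C_{S'}` are unions of cyclotomic cosets exchanged by `μ = -1`. This is the splitting, and reversing
coordinates identifies the two codes, whence equal distances.

The dual of a cyclic code with zeros `Z` has zeros `{i | -i ∉ Z}` (`dual_zeroCode`). Here that is
`{0}` together with the zeros of `C_S`, so the dual of `C_S` is its even-weight subcode. This gives
the even-like pair, the dimensions and the self-duality of the extension. A self-orthogonal even
cyclic code of odd length is doubly even, by counting autocorrelations modulo `4`; complementing
words passes this on to the extension.

For the distance, put `m = 2 * h + 1`. The residues `i * (2 ^ h - 1)` with `1 ≤ i ≤ 2 ^ h` all have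
weight `h`, so they, or else their negatives, are zeros of `C_S`. The BCH bound gives weight greater
than `2 ^ h`. Divisibility by `4` lifts this to `2 ^ h + 4` in the extension; puncturing gives `2 ^
h + 3`, and evenness restores `2 ^ h + 4` in the dual. The residue of `m` modulo `16` plays no role.
-/

theorem w₂_bit (a e : ℕ) (he : e < 2) : w₂ (2 * a + e) = w₂ a + e := by
  unfold w₂
  rcases Nat.eq_zero_or_pos (2 * a + e) with h | h
  · obtain ⟨rfl, rfl⟩ : a = 0 ∧ e = 0 := by omega
    simp
  · rw [Nat.digits_def' (by norm_num) h]
    have h1 : (2 * a + e) % 2 = e := by omega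
    have h2 : (2 * a + e) / 2 = a := by omega
    rw [h1, h2, List.sum_cons, add_comm]

theorem w₂_zero : w₂ 0 = 0 := by simp [w₂]

theorem w₂_two_mul (a : ℕ) : w₂ (2 * a) = w₂ a := by simpa using w₂_bit a 0 (by norm_num)

theorem w₂_mul_two_pow_add (k a b : ℕ) (hb : b < 2 ^ k) : w₂ (a * 2 ^ k + b) = w₂ a + w₂ b := by
  induction k generalizing b with
  | zero =>
    obtain rfl : b = 0 := by simpa using hb
    simp [w₂_zero]
  | succ k ih =>
    have hb2 : b / 2 < 2 ^ k := by rw [pow_succ] at hb; omega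
    have h1 : a * 2 ^ (k + 1) + b = 2 * (a * 2 ^ k + b / 2) + b % 2 := by
      rw [pow_succ]
      have := Nat.div_add_mod b 2
      nlinarith
    have h2 : w₂ b = w₂ (b / 2) + b % 2 := by
      rw [← w₂_bit _ _ (Nat.mod_lt _ two_pos), Nat.div_add_mod]
    rw [h1, w₂_bit _ _ (Nat.mod_lt _ two_pos), ih _ hb2, h2, add_assoc]

theorem w₂_complement (k b : ℕ) (hb : b < 2 ^ k) : w₂ (2 ^ k - 1 - b) + w₂ b = k := by
  induction k generalizing b with
  | zero =>
    obtain rfl : b = 0 := by simpa using hb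
    simp [w₂_zero]
  | succ k ih =>
    rw [pow_succ] at hb ⊢
    have hb2 : b / 2 < 2 ^ k := by omega
    have h1 : 2 ^ k * 2 - 1 - b = 2 * (2 ^ k - 1 - b / 2) + (1 - b % 2) := by omega
    have h2 : w₂ b = w₂ (b / 2) + b % 2 := by
      rw [← w₂_bit _ _ (Nat.mod_lt _ two_pos), Nat.div_add_mod]
    have := ih _ hb2
    rw [h1, w₂_bit _ _ (by omega), h2]
    omega

/-- With `j = i - 1` the product is `j * 2 ^ h + (2 ^ h - 1 - j)`: the high digits are those of `j`
and the low `h` digits are their complements. -/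
theorem w₂_mul_two_pow_sub_one (h i : ℕ) (hi : 1 ≤ i) (hi' : i ≤ 2 ^ h) :
    w₂ (i * (2 ^ h - 1)) = h := by
  obtain ⟨j, rfl⟩ := Nat.exists_eq_add_of_le' hi
  have h1 : (j + 1) * (2 ^ h - 1) = j * 2 ^ h + (2 ^ h - 1 - j) := by
    obtain ⟨c, hc⟩ := Nat.exists_eq_add_of_le hi'
    rw [hc, show j + 1 + c - 1 = j + c by omega, show j + c - j = c by omega]
    ring
  rw [h1, w₂_mul_two_pow_add _ _ _ (by omega), add_comm]
  exact w₂_complement h j (by omega)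

/-- The binary weight is invariant under doubling modulo `2 ^ m - 1`. -/
theorem w₂_val_two_mul {m : ℕ} (hm : 2 ≤ m) (i : ZMod (2 ^ m - 1)) :
    w₂ (2 * i).val = w₂ i.val := by
  obtain ⟨k, rfl⟩ := Nat.exists_eq_add_of_le' (show 1 ≤ m by omega)
  have h2 : 2 ≤ 2 ^ k := le_self_pow₀ (by norm_num) (by omega)
  have hp : 2 ^ (k + 1) - 1 = 2 * 2 ^ k - 1 := by rw [pow_succ, mul_comm]
  have : NeZero (2 ^ (k + 1) - 1) := ⟨by omega⟩
  have hlt := ZMod.val_lt i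
  rw [ZMod.val_mul, show (2 : ZMod (2 ^ (k + 1) - 1)) = ((2 : ℕ) : ZMod _) by norm_num,
    ZMod.val_natCast, Nat.mod_eq_of_lt (show 2 < 2 ^ (k + 1) - 1 by omega)]
  generalize i.val = j at *
  rw [hp] at *
  -- The top digit decides: if it is `0`, doubling is a plain shift; if it is `1`, reduction moves
  -- it to the bottom, giving `2 * r + 1`.
  rcases lt_or_ge j (2 ^ k) with h | h
  · rw [Nat.mod_eq_of_lt (by omega), w₂_two_mul]
  · rw [Nat.mod_eq_sub_mod (by omega), Nat.mod_eq_of_lt (by omega)]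
    obtain ⟨r, rfl⟩ := Nat.exists_eq_add_of_le h
    have h3 : 2 * (2 ^ k + r) - (2 * 2 ^ k - 1) = 2 * r + 1 := by omega
    have h4 := w₂_mul_two_pow_add k 1 r (by omega)
    have h5 : w₂ 1 = 1 := by simp [w₂]
    rw [h3, w₂_bit _ _ (by norm_num), ← one_mul (2 ^ k), h4, h5, add_comm]

theorem w₂_val_neg {m : ℕ} (i : ZMod (2 ^ m - 1)) (hm : 2 ≤ m) (hi : i ≠ 0) :
    w₂ (-i).val + w₂ i.val = m := by
  have h4 : 2 ^ 2 ≤ 2 ^ m := Nat.pow_le_pow_right (by norm_num) hm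
  have : NeZero (2 ^ m - 1) := ⟨by omega⟩
  have : NeZero i := ⟨hi⟩
  have hlt := ZMod.val_lt i
  rw [ZMod.val_neg_of_ne_zero]
  exact w₂_complement m _ (by omega)

/-! ### Minimum distance and coordinate permutations -/

variable {n : ℕ}

theorem minDist_comap_perm {A B : Code n} (σ : Equiv.Perm (Fin n))
    (h : ∀ c, c ∈ A ↔ c ∘ σ ∈ B) : minDist A = minDist B := by
  have hd (x y : Fin n → ZMod 2) : hammingDist (x ∘ σ) (y ∘ σ) = hammingDist x y := by
    unfold hammingDist
    exact Finset.card_bij (fun i _ => σ i) (by simp) (by simp)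
      (fun b hb => ⟨σ.symm b, by simpa using hb, by simp⟩)
  unfold minDist
  congr 1
  ext d
  constructor
  · rintro ⟨x, hx, y, hy, hne, hxy⟩
    exact ⟨x ∘ σ, (h x).1 hx, y ∘ σ, (h y).1 hy,
      fun e => hne (σ.surjective.injective_comp_right e), by rw [hd, hxy]⟩
  · rintro ⟨x, hx, y, hy, hne, hxy⟩
    have e (z : Fin n → ZMod 2) : (z ∘ σ.symm) ∘ σ = z := by ext; simp
    refine ⟨x ∘ σ.symm, (h _).2 (by rwa [e]), y ∘ σ.symm, (h _).2 (by rwa [e]),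
      fun e' => hne (σ.symm.surjective.injective_comp_right e'), ?_⟩
    rw [← hd, e, e, hxy]

theorem minDist_extend_comap_perm {A B : Code n} (σ : Equiv.Perm (Fin n))
    (h : ∀ c, c ∈ A ↔ c ∘ σ ∈ B) : minDist (extend A) = minDist (extend B) := by
  let τ : Equiv.Perm (Fin (n + 1)) :=
    (finSuccEquivLast.trans (Equiv.optionCongr σ)).trans finSuccEquivLast.symm
  have hτ (i : Fin n) : τ i.castSucc = (σ i).castSucc := by simp [τ]
  refine minDist_comap_perm τ fun c => ?_
  change (_ ∧ _) ↔ (_ ∧ _)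
  refine and_congr ?_ ?_
  · rw [h]
    simp only [Function.comp_def, hτ]
  · rw [← Equiv.sum_comp τ c]
    rfl

/-- A nonzero word is required because the infimum of the empty set is `0`. -/
theorem le_minDist {A : Code n} {d : ℕ} (hne : ∃ c ∈ A, c ≠ 0)
    (h : ∀ c ∈ A, c ≠ 0 → d ≤ hammingNorm c) : d ≤ minDist A := by
  obtain ⟨c, hc, hc0⟩ := hne
  refine le_csInf ⟨_, c, hc, 0, A.zero_mem, hc0, rfl⟩ ?_
  rintro _ ⟨x, hx, y, hy, hxy, rfl⟩
  rw [hammingDist_eq_hammingNorm]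
  exact h _ (A.add_mem (A.neg_mem hx) hy) fun e => hxy (neg_add_eq_zero.1 e)

/-! ### Dual and extended codes -/

theorem finrank_add_finrank_dual (A : Code n) :
    Module.finrank (ZMod 2) A + Module.finrank (ZMod 2) (dual A) = n := by
  let B : LinearMap.BilinForm (ZMod 2) (Fin n → ZMod 2) := Matrix.toBilin' 1
  have hB (x y : Fin n → ZMod 2) : B x y = x ⬝ᵥ y := by
    simp [B, Matrix.toBilin'_apply']
  have hnd : B.Nondegenerate := by
    rw [Matrix.nondegenerate_toBilin'_iff]
    exact Matrix.nondegenerate_of_det_ne_zero (by simp)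
  have hd : dual A = B.orthogonal A := by
    ext x
    rw [LinearMap.BilinForm.mem_orthogonal_iff]
    change (∀ c ∈ A, x ⬝ᵥ c = 0) ↔ _
    refine forall₂_congr fun c _ => ?_
    rw [hB, dotProduct_comm]
  rw [hd, LinearMap.BilinForm.finrank_orthogonal hnd]
  have := Submodule.finrank_le A
  simp only [Module.finrank_fin_fun] at *
  omega

theorem mem_extend {A : Code n} {x : Fin (n + 1) → ZMod 2} :
    x ∈ extend A ↔ (fun i : Fin n => x i.castSucc) ∈ A ∧ ∑ i, x i = 0 := Iff.rfl

theorem le_dual_dual (A : Code n) : A ≤ dual (dual A) := fun x hx c hc => by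
  rw [dotProduct_comm]; exact hc x hx

theorem dual_dual (A : Code n) : dual (dual A) = A := by
  refine (Submodule.eq_of_le_of_finrank_eq (le_dual_dual A) ?_).symm
  have h1 := finrank_add_finrank_dual A
  have h2 := finrank_add_finrank_dual (dual A)
  omega

/-- If the dual of a code of odd length is its even-weight subcode, the extended code is
self-dual. -/
theorem isSelfDual_extend {A : Code n} (hn : Odd n) (h1 : (1 : Fin n → ZMod 2) ∈ A)
    (hA : ∀ c, c ∈ dual A ↔ c ∈ A ∧ ∑ i, c i = 0) : IsSelfDual (extend A) := by
  have hn1 : (n : ZMod 2) = 1 := ZMod.natCast_eq_one_iff_odd.2 hn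
  apply le_antisymm
  · intro x hx y hy
    rw [mem_extend, Fin.sum_univ_castSucc] at hx hy
    obtain ⟨hx, sx⟩ := hx
    obtain ⟨hy, sy⟩ := hy
    set x' := fun i : Fin n => x i.castSucc with hx'
    set y' := fun i : Fin n => y i.castSucc with hy'
    -- Since `n` is odd, adding the all-one word when `x'` is odd makes it even. Its product with
    -- `y'` is `x' ⬝ᵥ y'` plus the product of the two parities, which is exactly the product of the
    -- extended words.
    have hE : x' + (∑ i, x' i) • (1 : Fin n → ZMod 2) ∈ dual A := by
      rw [hA]
      refine ⟨A.add_mem hx (A.smul_mem _ h1), ?_⟩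
      simp [Finset.sum_add_distrib, hn1, CharTwo.add_self_eq_zero]
    have := hE _ hy
    rw [add_dotProduct, smul_dotProduct, one_dotProduct] at this
    have ex : x (Fin.last n) = ∑ i, x' i := (CharTwo.add_eq_zero.1 sx).symm
    have ey : y (Fin.last n) = ∑ i, y' i := (CharTwo.add_eq_zero.1 sy).symm
    rw [dotProduct, Fin.sum_univ_castSucc, ex, ey]
    exact this
  · intro x hx
    rw [mem_extend]
    constructor
    · rw [← dual_dual A]
      -- Words of the dual, extended by `0`, are the test words that place `x` without its last
      -- coordinate in the double dual.
      intro e he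
      have he' := (hA e).1 he
      have : (Fin.snoc e 0 : Fin (n + 1) → ZMod 2) ∈ extend A := by
        rw [mem_extend]
        simp [Fin.sum_univ_castSucc, he'.1, he'.2]
      have := hx _ this
      simpa [dotProduct, Fin.sum_univ_castSucc] using this
    · have : (1 : Fin (n + 1) → ZMod 2) ∈ extend A := by
        rw [mem_extend]
        refine ⟨h1, ?_⟩
        simp [hn1, CharTwo.add_self_eq_zero]
      simpa [dotProduct_one] using hx _ this

theorem two_mul_finrank_of_isSelfDual {A : Code n} (hA : IsSelfDual A) :
    2 * Module.finrank (ZMod 2) A = n := by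
  have := finrank_add_finrank_dual A
  rw [← hA] at this
  omega

/-- If the even-weight subcode of a code of odd length containing the all-one word is its dual,
the dimensions of the two codes differ by one. -/
theorem finrank_eq_finrank_dual_add_one {A : Code n} (hn : Odd n) (h1 : (1 : Fin n → ZMod 2) ∈ A)
    (hA : ∀ c, c ∈ dual A ↔ c ∈ A ∧ ∑ i, c i = 0) :
    Module.finrank (ZMod 2) A = Module.finrank (ZMod 2) (dual A) + 1 := by
  have hn1 : (n : ZMod 2) = 1 := ZMod.natCast_eq_one_iff_odd.2 hn
  let s : (Fin n → ZMod 2) →ₗ[ZMod 2] ZMod 2 := ∑ i, LinearMap.proj i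
  have hs (c : Fin n → ZMod 2) : s c = ∑ i, c i := by simp [s]
  let f : A →ₗ[ZMod 2] ZMod 2 := s.domRestrict A
  have hr : LinearMap.range f = ⊤ := by
    rw [LinearMap.range_eq_top]
    intro a
    refine ⟨a • ⟨1, h1⟩, ?_⟩
    simp [f, hs, hn1]
  have hk : dual A = (LinearMap.ker f).map A.subtype := by
    ext c
    rw [hA, Submodule.mem_map]
    constructor
    · rintro ⟨hc, h0⟩
      exact ⟨⟨c, hc⟩, by simp [f, hs, h0], rfl⟩
    · rintro ⟨⟨c, hc⟩, h0, rfl⟩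
      refine ⟨hc, ?_⟩
      simpa [f, hs] using h0
  have := LinearMap.finrank_range_add_finrank_ker f
  rw [hr, finrank_top, Module.finrank_self] at this
  rw [hk, Submodule.finrank_map_subtype_eq]
  omega

theorem hammingNorm_castSucc_add (x : Fin (n + 1) → ZMod 2) :
    hammingNorm x = hammingNorm (fun i : Fin n => x i.castSucc) +
      (if x (Fin.last n) ≠ 0 then 1 else 0) := by
  simp only [hammingNorm, Finset.card_filter, Fin.sum_univ_castSucc]

theorem sum_eq_natCast_hammingNorm (x : Fin n → ZMod 2) : ∑ i, x i = (hammingNorm x : ZMod 2) := by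
  have (a : ZMod 2) : a = if a ≠ 0 then 1 else 0 := by revert a; decide
  rw [hammingNorm, Finset.card_filter, Nat.cast_sum]
  refine Finset.sum_congr rfl fun i _ => ?_
  rw [Nat.cast_ite, Nat.cast_one, Nat.cast_zero]
  exact this _

theorem hammingNorm_add_one_compl (x : Fin n → ZMod 2) :
    hammingNorm (x + 1) + hammingNorm x = n := by
  have h (a : ZMod 2) : (if a + 1 ≠ 0 then 1 else 0) + (if a ≠ 0 then 1 else 0) = 1 := by
    revert a; decide
  simp only [hammingNorm, Finset.card_filter, ← Finset.sum_add_distrib, Pi.add_apply, Pi.one_apply,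
    h]
  simp

/-- If the even-weight subcode of `A` is doubly even and `4 ∣ n + 1`, the extended code is doubly
even. -/
theorem isDoublyEven_extend {A : Code n} (hn : 4 ∣ n + 1) (h1 : (1 : Fin n → ZMod 2) ∈ A)
    (hA : ∀ c ∈ A, ∑ i, c i = 0 → 4 ∣ hammingNorm c) : IsDoublyEven (extend A) := by
  intro x hx
  rw [mem_extend, Fin.sum_univ_castSucc] at hx
  obtain ⟨hx, sx⟩ := hx
  rw [hammingNorm_castSucc_add]
  have ex : x (Fin.last n) = ∑ i : Fin n, x i.castSucc := (CharTwo.add_eq_zero.1 sx).symm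
  set x' := fun i : Fin n => x i.castSucc with hx'
  by_cases h : x (Fin.last n) = 0
  · rw [if_neg (by simpa using h), add_zero]
    exact hA _ hx (by rw [← ex, h])
  · rw [if_pos h]
    have h' : x (Fin.last n) = 1 := (Fin.eq_one_of_ne_zero _ h)
    have hn1 : (n : ZMod 2) = 1 := by
      rw [ZMod.natCast_eq_one_iff_odd, Nat.odd_iff]; omega
    -- When the added coordinate is `1`, the complement is even, so `4 ∣ n - wt(x')`; with `4 ∣ n +
    -- 1` this gives `4 ∣ wt(x') + 1`.
    have := hA _ (A.add_mem hx h1) (by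
      simp only [Pi.add_apply, Finset.sum_add_distrib, Pi.one_apply, Finset.sum_const,
        Finset.card_univ, Fintype.card_fin, nsmul_eq_mul, mul_one, hn1]
      rw [← ex, h']; decide)
    have h2 := hammingNorm_add_one_compl x'
    omega

end

section

/-! ### Autocorrelation -/

/-- Let `A` be a set of even size in a group of odd order whose autocorrelation numbers are even
away from `0`. Then the size of `A` is divisible by four. -/
theorem four_dvd_card_of_even_autocorrelation {G : Type*} [AddCommGroup G] [Fintype G]
    [DecidableEq G] (hG : Odd (Fintype.card G)) (A : Finset G) (hA : Even A.card)
    (h : ∀ k : G, k ≠ 0 → Even {x ∈ A | x + k ∈ A}.card) : 4 ∣ A.card := by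
  set a : G → ℕ := fun k => {x ∈ A | x + k ∈ A}.card with ha
  have hneg (k : G) : a (-k) = a k := by
    refine Finset.card_bij' (fun x _ => x + -k) (fun x _ => x + k) ?_ ?_ ?_ ?_ <;>
      simp +contextual
  have hsum : ∑ k, a k = A.card * A.card := by
    simp only [ha, Finset.card_filter]
    rw [Finset.sum_comm]
    rw [← smul_eq_mul, ← Finset.sum_const]
    refine Finset.sum_congr rfl fun x _ => ?_
    rw [← Finset.card_filter]
    exact Finset.card_bij' (fun k _ => x + k) (fun y _ => y - x) (by simp) (by simp) (by simp)
      (by simp)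
  have h0 : a 0 = A.card := by simp [ha]
  choose! b hb using h
  have hb' (k : G) (hk : k ≠ 0) : a k = 2 * b k := by rw [two_mul]; exact hb k hk
  have hfix (k : G) (hk : k ≠ 0) : -k ≠ k := by
    intro e
    have h2 : (2 : ℕ) • k = 0 := by
      rw [two_nsmul]; nth_rewrite 1 [← e]; simp
    have h3 := (addOrderOf_dvd_of_nsmul_eq_zero h2)
    have h4 := addOrderOf_dvd_card (x := k)
    have : addOrderOf k ∣ 1 := by
      rw [← (Nat.coprime_two_left.2 hG).gcd_eq_one]; exact Nat.dvd_gcd h3 h4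
    exact hk (AddMonoid.addOrderOf_eq_one_iff.1 (Nat.dvd_one.1 this))
  -- Pairing `k` with `-k`, distinct in odd order, makes the sum of the halved autocorrelations
  -- even. Hence `|A| ^ 2 - |A|` is divisible by `4`, and so is `|A| ^ 2`.
  have heven : ((∑ k ∈ Finset.univ.erase 0, b k : ℕ) : ZMod 2) = 0 := by
    rw [Nat.cast_sum]
    refine Finset.sum_involution (fun k _ => -k) ?_ ?_ (by simp) (by simp)
    · intro k hk
      have hk := Finset.ne_of_mem_erase hk
      have : b (-k) = b k := by
        have h1 := hb' k hk
        have h2 := hb' (-k) (neg_ne_zero.2 hk)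
        rw [hneg] at h2
        omega
      rw [this, CharTwo.add_self_eq_zero]
    · intro k hk _
      exact hfix k (Finset.ne_of_mem_erase hk)
  rw [ZMod.natCast_eq_zero_iff] at heven
  have hs : A.card + 2 * ∑ k ∈ Finset.univ.erase 0, b k = A.card * A.card := by
    rw [← hsum, ← Finset.add_sum_erase _ _ (Finset.mem_univ (0 : G)), h0, Finset.mul_sum]
    congr 1
    exact Finset.sum_congr rfl fun k hk => (hb' k (Finset.ne_of_mem_erase hk)).symm
  obtain ⟨c, hc⟩ := heven
  obtain ⟨e, he⟩ := hA
  rw [hc] at hs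
  have h5 : 4 ∣ A.card * A.card := ⟨e * e, by rw [he]; ring⟩
  omega

/-! ### Words and characters -/

variable {n : ℕ} [NeZero n]

/-- Coordinates of words of length `n`, as residues modulo `n`. -/
def finZMod (n : ℕ) [NeZero n] : Fin n ≃ ZMod n where
  toFun j := (j : ℕ)
  invFun i := ⟨i.val, ZMod.val_lt i⟩
  left_inv j := Fin.ext (ZMod.val_cast_of_lt j.isLt)
  right_inv i := ZMod.natCast_zmod_val i

variable {K : Type*} [Field K] [Algebra (ZMod 2) K]

/-- The code of all words whose polynomial vanishes at `α ^ i` for all `i ∈ Z`. -/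
def zeroCode (α : Kˣ) (Z : Set (ZMod n)) : Code n where
  carrier := {c | ∀ i ∈ Z, aeval ((α : K) ^ i.val) (toPoly c) = 0}
  zero_mem' := by simp [toPoly]
  add_mem' := by
    intro x y hx hy i hi
    have h : toPoly (x + y) = toPoly x + toPoly y := by
      simp [toPoly, add_mul, Finset.sum_add_distrib]
    rw [h, map_add, hx i hi, hy i hi, add_zero]
  smul_mem' := by
    intro a x hx i hi
    have h : toPoly (a • x) = C a * toPoly x := by
      simp [toPoly, Finset.mul_sum, mul_assoc]
    rw [h, map_mul, hx i hi, mul_zero]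

omit [NeZero n] in
theorem mem_zeroCode {α : Kˣ} {Z : Set (ZMod n)} {c : Fin n → ZMod 2} :
    c ∈ zeroCode α Z ↔ ∀ i ∈ Z, aeval ((α : K) ^ i.val) (toPoly c) = 0 := Iff.rfl

omit [NeZero n] [Algebra (ZMod 2) K] in
theorem isPrimitiveRoot_of_orderOf {α : Kˣ} (hα : orderOf α = n) : IsPrimitiveRoot (α : K) n := by
  rw [← hα]
  exact IsPrimitiveRoot.coe_units_iff.2 (IsPrimitiveRoot.orderOf α)

/-- The character `i ↦ α ^ i` of `ZMod n`, for `α` of order `n`. -/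
def rootChar {α : Kˣ} (hα : orderOf α = n) : AddChar (ZMod n) K :=
  AddChar.zmodChar n (isPrimitiveRoot_of_orderOf hα).pow_eq_one

variable {α : Kˣ} (hα : orderOf α = n)

omit [Algebra (ZMod 2) K] in
theorem rootChar_apply (i : ZMod n) : rootChar hα i = (α : K) ^ i.val := rfl

include hα in
omit [Algebra (ZMod 2) K] in
theorem root_injective : Function.Injective fun i : ZMod n => (α : K) ^ i.val := fun i j h =>
  ZMod.val_injective n
    ((isPrimitiveRoot_of_orderOf hα).pow_inj (ZMod.val_lt i) (ZMod.val_lt j) h)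

omit [Algebra (ZMod 2) K] in
theorem rootChar_mul_natCast (i : ZMod n) (k : ℕ) : rootChar hα (i * k) = rootChar hα i ^ k := by
  rw [mul_comm, ← nsmul_eq_mul, AddChar.map_nsmul_eq_pow]

omit [Algebra (ZMod 2) K] in
theorem sum_rootChar_mul (a : ZMod n) :
    ∑ x, rootChar hα (a * x) = if a = 0 then (n : K) else 0 := by
  have h := AddChar.sum_mulShift a
    (AddChar.zmodChar_primitive_of_primitive_root n (isPrimitiveRoot_of_orderOf hα))
  rw [ZMod.card] at h
  rw [Nat.cast_ite, Nat.cast_zero] at h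
  rw [← h]
  exact Finset.sum_congr rfl fun x _ => by rw [mul_comm]; rfl

theorem aeval_toPoly (i : ZMod n) (c : Fin n → ZMod 2) :
    aeval ((α : K) ^ i.val) (toPoly c) =
      ∑ j, algebraMap (ZMod 2) K (c j) * rootChar hα (i * finZMod n j) := by
  simp only [toPoly, map_sum, map_mul, aeval_C, map_pow, aeval_X]
  refine Finset.sum_congr rfl fun j _ => ?_
  rw [← rootChar_apply hα, ← rootChar_mul_natCast]
  rfl

/-- Permuting the coordinates of a word by a permutation of `ZMod n`. -/
def coordPerm (σ : Equiv.Perm (ZMod n)) : Equiv.Perm (Fin n) :=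
  ((finZMod n).trans σ).trans (finZMod n).symm

theorem finZMod_coordPerm (σ : Equiv.Perm (ZMod n)) (j : Fin n) :
    finZMod n (coordPerm σ j) = σ (finZMod n j) := by simp [coordPerm]

include hα in
theorem aeval_toPoly_comp_shift (k i : ZMod n) (c : Fin n → ZMod 2) :
    aeval ((α : K) ^ i.val) (toPoly (c ∘ coordPerm (Equiv.addRight k))) =
      rootChar hα (-(i * k)) * aeval ((α : K) ^ i.val) (toPoly c) := by
  rw [aeval_toPoly hα, aeval_toPoly hα, Finset.mul_sum,
    ← Equiv.sum_comp (coordPerm (Equiv.addRight k)) (fun j => rootChar hα (-(i * k)) * _)]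
  refine Finset.sum_congr rfl fun j _ => ?_
  rw [finZMod_coordPerm, Equiv.coe_addRight, mul_left_comm, ← AddChar.map_add_eq_mul]
  congr 2
  ring

include hα in
theorem aeval_toPoly_comp_neg (i : ZMod n) (c : Fin n → ZMod 2) :
    aeval ((α : K) ^ i.val) (toPoly (c ∘ coordPerm (Equiv.neg (ZMod n)))) =
      aeval ((α : K) ^ (-i).val) (toPoly c) := by
  rw [aeval_toPoly hα, aeval_toPoly hα, ← Equiv.sum_comp (coordPerm (Equiv.neg (ZMod n)))
    (fun j => algebraMap (ZMod 2) K (c j) * _)]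
  refine Finset.sum_congr rfl fun j _ => ?_
  rw [finZMod_coordPerm, Equiv.neg_apply, neg_mul_neg]
  rfl

include hα in
theorem mem_zeroCode_iff_comp_neg {Z W : Set (ZMod n)} (h : ∀ i, i ∈ W ↔ -i ∈ Z)
    (c : Fin n → ZMod 2) :
    c ∈ zeroCode α Z ↔ c ∘ coordPerm (Equiv.neg (ZMod n)) ∈ zeroCode α W := by
  simp only [mem_zeroCode, aeval_toPoly_comp_neg hα, h]
  exact ⟨fun H i hi => H _ hi, fun H i hi => by simpa using H (-i) (by simpa using hi)⟩

include hα in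
theorem comp_shift_mem_zeroCode {Z : Set (ZMod n)} {c : Fin n → ZMod 2} (k : ZMod n)
    (hc : c ∈ zeroCode α Z) : c ∘ coordPerm (Equiv.addRight k) ∈ zeroCode α Z := fun i hi => by
  rw [aeval_toPoly_comp_shift hα, hc i hi, mul_zero]

omit [NeZero n] in
theorem aeval_zero_toPoly (c : Fin n → ZMod 2) :
    aeval ((α : K) ^ (0 : ZMod n).val) (toPoly c) = algebraMap (ZMod 2) K (∑ i, c i) := by
  simp [toPoly]

omit [NeZero n] in
theorem mem_zeroCode_insert_zero {Z : Set (ZMod n)} {c : Fin n → ZMod 2} :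
    c ∈ zeroCode α ({0} ∪ Z) ↔ c ∈ zeroCode α Z ∧ ∑ i, c i = 0 := by
  simp only [mem_zeroCode, Set.mem_union, Set.mem_singleton_iff, or_imp, forall_and, forall_eq,
    aeval_zero_toPoly, map_eq_zero]
  exact and_comm

include hα in
theorem one_mem_zeroCode {Z : Set (ZMod n)} (hZ : 0 ∉ Z) :
    (1 : Fin n → ZMod 2) ∈ zeroCode α Z := by
  intro i hi
  rw [aeval_toPoly hα]
  simp only [Pi.one_apply, map_one, one_mul]
  rw [Equiv.sum_comp (finZMod n) (fun x => rootChar hα (i * x)), sum_rootChar_mul,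
    if_neg (by rintro rfl; exact hZ hi)]

/-! ### The BCH bound -/

include hα in
/-- The BCH bound: a nonzero word whose polynomial vanishes at `α ^ (u * i)` for `1 ≤ i ≤ d`,
with `u` a unit modulo `n`, has weight greater than `d`. -/
theorem lt_hammingNorm_of_mem_zeroCode {Z : Set (ZMod n)} {c : Fin n → ZMod 2}
    (hc : c ∈ zeroCode α Z) (hc0 : c ≠ 0) {u : ZMod n} (hu : IsUnit u) {d : ℕ}
    (hZ : ∀ i : ℕ, 1 ≤ i → i ≤ d → u * i ∈ Z) : d < hammingNorm c := by
  classical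
  by_contra! hd
  let A : Finset (Fin n) := {j | c j ≠ 0}
  have hA : A.card ≤ d := hd
  obtain ⟨j₀, hj₀⟩ : ∃ j, c j ≠ 0 := Function.ne_iff.1 hc0
  have hj₀A : j₀ ∈ A := by simpa [A] using hj₀
  let x : Fin n → K := fun j => rootChar hα (u * finZMod n j)
  have hx : Function.Injective x := fun i j h =>
    (finZMod n).injective (hu.mul_left_cancel (root_injective hα h))
  -- Among the support points, `p` is nonzero only at `x j₀`. The factor `X` removes the constant
  -- term, because the zeros are only assumed from exponent `1` on; the degree is the weight, at
  -- most `d`.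
  let p : K[X] := X * ∏ j ∈ A.erase j₀, (X - C (x j))
  have hp : p.natDegree < d + 1 := by
    have h1 : (∏ j ∈ A.erase j₀, (X - C (x j))).natDegree = A.card - 1 := by
      rw [natDegree_prod_of_monic _ _ fun j _ => monic_X_sub_C _]
      simp [Finset.card_erase_of_mem hj₀A]
    have h2 := natDegree_mul_le (p := X) (q := ∏ j ∈ A.erase j₀, (X - C (x j)))
    have h3 : 0 < A.card := Finset.card_pos.2 ⟨_, hj₀A⟩
    rw [natDegree_X, h1] at h2
    exact lt_of_le_of_lt h2 (by omega)
  have hp0 : p.coeff 0 = 0 := by simp [p]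
  have hsum : ∑ j, algebraMap (ZMod 2) K (c j) * p.eval (x j) = 0 := by
    simp only [eval_eq_sum_range' hp, Finset.mul_sum]
    rw [Finset.sum_comm]
    refine Finset.sum_eq_zero fun i hi => ?_
    rcases Nat.eq_zero_or_pos i with rfl | hi0
    · simp [hp0]
    · have h1 := hc _ (hZ i hi0 (by simpa [Nat.lt_succ_iff] using hi))
      rw [aeval_toPoly hα] at h1
      rw [← mul_zero (p.coeff i), ← h1, Finset.mul_sum]
      refine Finset.sum_congr rfl fun j _ => ?_
      rw [mul_left_comm, mul_right_comm, rootChar_mul_natCast]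
  rw [Finset.sum_eq_single j₀] at hsum
  · rw [mul_eq_zero, or_iff_right (by simpa using hj₀)] at hsum
    simp only [p, eval_mul, eval_X, eval_prod, eval_sub, eval_C, mul_eq_zero,
      Finset.prod_eq_zero_iff, sub_eq_zero] at hsum
    rcases hsum with h | ⟨j, hj, h⟩
    · exact (pow_ne_zero _ α.ne_zero) h
    · exact Finset.ne_of_mem_erase hj (hx h).symm
  · intro j _ hj
    by_cases hcj : c j = 0
    · simp [hcj]
    · have : p.eval (x j) = 0 := by
        simp only [p, eval_mul, eval_prod]
        rw [Finset.prod_eq_zero (i := j) (by simp [A, hj, hcj]) (by simp), mul_zero]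
      rw [this, mul_zero]
  · simp

end

section

variable {n : ℕ} [NeZero n] {K : Type*} [Field K] [Algebra (ZMod 2) K] {α : Kˣ}
  (hα : orderOf α = n)

/-! ### Generator polynomials -/

theorem prod_X_sub_C_dvd_iff {F ι : Type*} [Field F] {s : Finset ι} {f : ι → F}
    (hf : Set.InjOn f s) (q : F[X]) :
    ∏ i ∈ s, (X - C (f i)) ∣ q ↔ ∀ i ∈ s, q.eval (f i) = 0 := by
  constructor
  · intro h i hi
    exact dvd_iff_isRoot.1 ((Finset.dvd_prod_of_mem (fun i => X - C (f i)) hi).trans h)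
  · intro h
    refine Finset.prod_dvd_of_coprime (fun i hi j hj hij => ?_) fun i hi => dvd_iff_isRoot.2 (h i hi)
    exact isCoprime_X_sub_C_of_isUnit_sub
      (IsUnit.mk0 _ (sub_ne_zero.2 fun e => hij (hf hi hj e)))

include hα in
theorem cyclicCode_eq_zeroCode {r m : ℕ} (hn : n = 2 ^ m - 1) (S : Finset (ZMod r)) :
    codeOfGenerator n (genPoly r m α S) =
      zeroCode α {i : ZMod n | i ≠ 0 ∧ (w₂ i.val : ZMod r) ∈ S} := by
  ext c
  change genPoly r m α S ∣ _ ↔ _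
  have hT (j : ℕ) : j ∈ T r m S ↔ (1 ≤ j ∧ j < n) ∧ (w₂ j : ZMod r) ∈ S := by
    simp only [T, Finset.mem_filter, Finset.mem_Icc]
    have := NeZero.pos n
    rw [show j ≤ 2 ^ m - 2 ↔ j < n by omega]
  have hinj : Set.InjOn (fun j => (α : K) ^ j) (T r m S) := fun i hi j hj h =>
    (isPrimitiveRoot_of_orderOf hα).pow_inj ((hT i).1 hi).1.2 ((hT j).1 hj).1.2 h
  rw [genPoly, prod_X_sub_C_dvd_iff hinj]
  simp only [eval_map_algebraMap]
  constructor
  · rintro h i ⟨hi, hS⟩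
    exact h _ ((hT _).2 ⟨⟨Nat.one_le_iff_ne_zero.2 (by simpa using hi), ZMod.val_lt i⟩, hS⟩)
  · intro h j hj
    obtain ⟨⟨h1, h2⟩, h3⟩ := (hT j).1 hj
    have hv : (j : ZMod n).val = j := ZMod.val_cast_of_lt h2
    have := h (j : ZMod n) ⟨fun e => by rw [← ZMod.val_eq_zero, hv] at e; omega, by rwa [hv]⟩
    rwa [hv] at this

theorem mem_range_algebraMap_of_sq_eq {x : K} (hx : x ^ 2 = x) :
    x ∈ Set.range (algebraMap (ZMod 2) K) := by
  have : x * (x - 1) = 0 := by ring_nf; rw [hx]; ring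
  rcases mul_eq_zero.1 this with h | h
  · exact ⟨0, by rw [map_zero, h]⟩
  · exact ⟨1, by rw [map_one, sub_eq_zero.1 h]⟩

include hα in
-- Doubling permutes `Z`, so Frobenius fixes the product of the factors `X - α ^ i`; its
-- coefficients therefore lie in the prime field and it descends to a binary generator.
theorem hasDefiningSet_zeroCode (hn : Odd n) {Z : Set (ZMod n)} (hZ : ∀ i ∈ Z, 2 * i ∈ Z) :
    HasDefiningSet α (zeroCode α Z) Z := by
  classical
  have : CharP K 2 := charP_of_injective_algebraMap (algebraMap (ZMod 2) K).injective 2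
  let s : Finset (ZMod n) := Set.toFinset Z
  have hs (i : ZMod n) : i ∈ s ↔ i ∈ Z := Set.mem_toFinset
  have hinj : Set.InjOn (fun i : ZMod n => (α : K) ^ i.val) s := (root_injective hα).injOn
  let P : K[X] := ∏ i ∈ s, (X - C ((α : K) ^ i.val))
  have hP : P.map (frobenius K 2) = P := by
    have h2 : IsUnit (2 : ZMod n) := by
      have := (ZMod.isUnit_iff_coprime 2 n).2 (Nat.coprime_two_left.2 hn)
      simpa using this
    have himg : s.image (fun i => 2 * i) = s := by
      refine Finset.eq_of_subset_of_card_le ?_ ?_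
      · intro x hx
        obtain ⟨i, hi, rfl⟩ := Finset.mem_image.1 hx
        exact (hs _).2 (hZ _ ((hs _).1 hi))
      · rw [Finset.card_image_of_injective _ fun _ _ h => h2.mul_left_cancel h]
    simp only [P, Polynomial.map_prod]
    conv_rhs => rw [← himg, Finset.prod_image fun _ _ _ _ h => h2.mul_left_cancel h]
    refine Finset.prod_congr rfl fun i _ => ?_
    rw [Polynomial.map_sub, map_X, map_C, frobenius_def, ← rootChar_apply hα,
      ← rootChar_apply hα, ← rootChar_mul_natCast, Nat.cast_two, mul_comm]
  obtain ⟨g, hg⟩ : ∃ g : (ZMod 2)[X], g.map (algebraMap (ZMod 2) K) = P := by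
    rw [← mem_lifts, lifts_iff_coeff_lifts]
    intro k
    refine mem_range_algebraMap_of_sq_eq ?_
    conv_rhs => rw [← hP]
    rw [coeff_map, frobenius_def]
  have hdvd (q : (ZMod 2)[X]) : g ∣ q ↔ ∀ i ∈ Z, aeval ((α : K) ^ i.val) q = 0 := by
    rw [← map_dvd_map' (algebraMap (ZMod 2) K), hg, prod_X_sub_C_dvd_iff hinj]
    simp only [eval_map_algebraMap, hs]
  refine ⟨g, ⟨?_, ?_, fun c => ?_⟩, ?_⟩
  · rw [(algebraMap (ZMod 2) K).injective.monic_map_iff, hg]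
    exact monic_prod_of_monic _ _ fun i _ => monic_X_sub_C _
  · rw [hdvd]
    intro i _
    rw [map_sub, map_pow, aeval_X, map_one, ← pow_mul, mul_comm, pow_mul,
      (isPrimitiveRoot_of_orderOf hα).pow_eq_one, one_pow, sub_self]
  · rw [hdvd, mem_zeroCode]
  · ext i
    rw [Set.mem_ofPred_eq, ← eval_map_algebraMap, hg]
    simp only [P, eval_prod, eval_sub, eval_X, eval_C, Finset.prod_eq_zero_iff, sub_eq_zero, hs]
    constructor
    · exact fun h => ⟨i, h, rfl⟩
    · rintro ⟨j, hj, h⟩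
      rwa [root_injective hα h]

/-! ### Duals of cyclic codes -/

include hα in
-- Parseval: the inner product is the sum over `i` of the transform of `x` at `i` times that of `y`
-- at `-i`, and every term has a vanishing factor. The factor `n` is `1` because `n` is odd.
theorem dotProduct_eq_zero_of_mem_zeroCode (hn : Odd n) {Z W : Set (ZMod n)}
    (h : ∀ i, i ∈ W ∨ -i ∈ Z) {x y : Fin n → ZMod 2} (hx : x ∈ zeroCode α W)
    (hy : y ∈ zeroCode α Z) : x ⬝ᵥ y = 0 := by
  have : CharP K 2 := charP_of_injective_algebraMap (algebraMap (ZMod 2) K).injective 2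
  have hn1 : (n : K) = 1 := by
    rw [← map_natCast (algebraMap (ZMod 2) K), ZMod.natCast_eq_one_iff_odd.2 hn, map_one]
  have h0 : ∑ i : ZMod n, aeval ((α : K) ^ i.val) (toPoly x) *
      aeval ((α : K) ^ (-i).val) (toPoly y) = 0 := by
    refine Finset.sum_eq_zero fun i _ => ?_
    rcases h i with h | h
    · rw [hx i h, zero_mul]
    · rw [hy _ h, mul_zero]
  simp only [aeval_toPoly hα, Finset.sum_mul_sum] at h0
  rw [Finset.sum_comm] at h0
  have h1 (j k : Fin n) : ∑ i : ZMod n, (algebraMap (ZMod 2) K (x j) *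
      rootChar hα (i * finZMod n j)) * (algebraMap (ZMod 2) K (y k) *
      rootChar hα (-i * finZMod n k)) =
      if j = k then algebraMap (ZMod 2) K (x j * y k) else 0 := by
    have e (i : ZMod n) : (algebraMap (ZMod 2) K (x j) *
      rootChar hα (i * finZMod n j)) * (algebraMap (ZMod 2) K (y k) *
      rootChar hα (-i * finZMod n k)) = algebraMap (ZMod 2) K (x j * y k) *
        rootChar hα ((finZMod n j - finZMod n k) * i) := by
      rw [mul_mul_mul_comm, ← AddChar.map_add_eq_mul, map_mul]
      congr 2
      ring
    simp only [e]
    rw [← Finset.mul_sum, sum_rootChar_mul, hn1]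
    simp only [sub_eq_zero, (finZMod n).injective.eq_iff, mul_ite, mul_one, mul_zero]
  refine (algebraMap (ZMod 2) K).injective ?_
  rw [map_zero, ← h0, dotProduct, map_sum]
  refine Finset.sum_congr rfl fun j _ => ?_
  rw [Finset.sum_comm]
  simp only [h1]
  rw [Finset.sum_ite_eq, if_pos (Finset.mem_univ _)]

theorem two_pow_mul_mem_iff (hn : Odd n) {Z : Set (ZMod n)} (hZ : ∀ i ∈ Z, 2 * i ∈ Z)
    (t : ℕ) (i : ZMod n) : 2 ^ t * i ∈ Z ↔ i ∈ Z := by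
  have hp (s : ℕ) (i : ZMod n) (hi : i ∈ Z) : 2 ^ s * i ∈ Z := by
    induction s with
    | zero => simpa using hi
    | succ s ih => rw [pow_succ', mul_assoc]; exact hZ _ ih
  refine ⟨fun h => ?_, hp t i⟩
  have h1 : ((2 : ZMod n) ^ t) ^ n.totient = 1 := by
    have := ZMod.pow_totient (ZMod.unitOfCoprime 2 (Nat.coprime_two_left.2 hn))
    have := congrArg Units.val this
    rw [Units.val_pow_eq_pow_val, ZMod.coe_unitOfCoprime, Units.val_one, Nat.cast_two] at this
    rw [← pow_mul, mul_comm, pow_mul, this, one_pow]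
  -- By Euler's theorem the inverse of `2 ^ t` is again a power of `2`, so closure under doubling
  -- can be undone.
  have h2 := hp (t * (n.totient - 1)) _ h
  rwa [← mul_assoc, pow_mul, ← pow_succ,
    Nat.sub_add_cancel (Nat.totient_pos.2 (NeZero.pos n)), h1, one_mul] at h2

include hα in
theorem dual_zeroCode [Finite K] (hn : Odd n) {Z : Set (ZMod n)} (hZ : ∀ i ∈ Z, 2 * i ∈ Z) :
    dual (zeroCode α Z) = zeroCode α {i | -i ∉ Z} := by
  have : CharP K 2 := charP_of_injective_algebraMap (algebraMap (ZMod 2) K).injective 2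
  have : Fact (Nat.Prime 2) := ⟨Nat.prime_two⟩
  apply le_antisymm
  · intro x hx i hi
    by_contra hne
    have hnd := (traceForm_nondegenerate (ZMod 2) K).1 (aeval ((α : K) ^ i.val) (toPoly x))
    simp only [Algebra.traceForm_apply] at hnd
    refine hne (hnd fun l => ?_)
    -- The trace words of frequency `i` lie in the code, so orthogonality to them says that the
    -- transform of `x` at `i` is trace-orthogonal to every `l`; nondegeneracy of the trace form
    -- then makes it zero.
    let y : Fin n → ZMod 2 := fun j =>
      Algebra.trace (ZMod 2) K (rootChar hα (i * finZMod n j) * l)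
    have hy : y ∈ zeroCode α Z := by
      intro k hk
      rw [aeval_toPoly hα]
      simp only [y, FiniteField.algebraMap_trace_eq_sum_pow, Nat.card_zmod, Finset.sum_mul]
      rw [Finset.sum_comm]
      refine Finset.sum_eq_zero fun t _ => ?_
      have e (j : Fin n) : (rootChar hα (i * finZMod n j) * l) ^ 2 ^ t *
          rootChar hα (k * finZMod n j) =
          l ^ 2 ^ t * rootChar hα ((2 ^ t * i + k) * finZMod n j) := by
        rw [mul_pow, ← rootChar_mul_natCast, mul_right_comm, ← AddChar.map_add_eq_mul, mul_comm]
        congr 2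
        push_cast
        ring
      simp only [e]
      rw [← Finset.mul_sum, Equiv.sum_comp (finZMod n)
        (fun x => rootChar hα ((2 ^ t * i + k) * x)), sum_rootChar_mul, if_neg, mul_zero]
      -- The conjugates of `y` have frequencies `2 ^ t * i`. One of them cancels `k ∈ Z` only if `2
      -- ^ t * (-i) ∈ Z`, which would force `-i ∈ Z`.
      intro h
      refine hi ((two_pow_mul_mem_iff hn hZ t (-i)).1 ?_)
      rwa [mul_neg, ← eq_neg_of_add_eq_zero_right h]
    have h0 := hx y hy
    rw [aeval_toPoly hα, Finset.sum_mul, map_sum, ← h0, dotProduct]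
    refine Finset.sum_congr rfl fun j _ => ?_
    rw [mul_assoc, ← Algebra.smul_def, map_smul, smul_eq_mul]
  · intro x hx y hy
    exact dotProduct_eq_zero_of_mem_zeroCode hα hn (fun i => (em (-i ∈ Z)).symm) hx hy

/-! ### Divisibility of weights by four -/

/-- A self-orthogonal even cyclic code of odd length is doubly even. -/
theorem four_dvd_hammingNorm (hn : Odd n) {A : Code n}
    (hA : ∀ c ∈ A, ∀ k, c ∘ coordPerm (Equiv.addRight k) ∈ A) (hd : A ≤ dual A)
    {c : Fin n → ZMod 2} (hc : c ∈ A) (h0 : ∑ i, c i = 0) : 4 ∣ hammingNorm c := by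
  classical
  let B : Finset (ZMod n) := {x | c ((finZMod n).symm x) ≠ 0}
  have hB : B.card = hammingNorm c := by
    refine (Finset.card_equiv (finZMod n) ?_).symm
    simp [B]
  rw [← hB]
  refine four_dvd_card_of_even_autocorrelation (by rwa [ZMod.card]) B ?_ fun k _ => ?_
  · rw [hB, ← ZMod.natCast_eq_zero_iff_even, ← sum_eq_natCast_hammingNorm, h0]
  · have h1 := hd hc _ (hA c hc k)
    rw [← ZMod.natCast_eq_zero_iff_even, ← h1, dotProduct, Finset.card_filter,
      Nat.cast_sum, Finset.sum_filter, ← Equiv.sum_comp (finZMod n)]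
    refine Finset.sum_congr rfl fun j _ => ?_
    have e (a b : ZMod 2) : (if a ≠ 0 then ((if b ≠ 0 then 1 else 0 : ℕ) : ZMod 2) else 0) =
      a * b := by revert a b; decide
    simp only [B, Finset.mem_filter, Finset.mem_univ, true_and, Equiv.symm_apply_apply]
    rw [e]
    simp [coordPerm]

end

section

/-! ### The codes `C_{[r,m,S]}` with `S` complementary to `m - S` -/

/-- The nonzero residues modulo `2 ^ m - 1` whose binary weight modulo `r` lies in `S`. -/
def weightZeros (r m : ℕ) (S : Finset (ZMod r)) : Set (ZMod (2 ^ m - 1)) :=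
  {i | i ≠ 0 ∧ (w₂ i.val : ZMod r) ∈ S}

theorem exists_ne_zero_of_finrank_pos {n : ℕ} {A : Code n}
    (h : 0 < Module.finrank (ZMod 2) A) : ∃ c ∈ A, c ≠ 0 := by
  refine A.exists_mem_ne_zero_of_ne_bot ?_
  rintro rfl
  simp at h

theorem odd_two_pow_sub_one {m : ℕ} (hm : m ≠ 0) : Odd (2 ^ m - 1) :=
  Nat.Even.sub_odd Nat.one_le_two_pow (Nat.even_pow.2 ⟨even_two, hm⟩) odd_one

section

variable {r m : ℕ} [NeZero r] {S : Finset (ZMod r)}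

omit [NeZero r] in
theorem two_mul_mem_weightZeros (hm : 2 ≤ m) {i : ZMod (2 ^ m - 1)}
    (hi : i ∈ weightZeros r m S) : 2 * i ∈ weightZeros r m S := by
  have h2 : Odd (2 ^ m - 1) := odd_two_pow_sub_one (by omega)
  have hu : IsUnit (2 : ZMod (2 ^ m - 1)) := by
    have := (ZMod.isUnit_iff_coprime 2 (2 ^ m - 1)).2 (Nat.coprime_two_left.2 h2)
    simpa using this
  refine ⟨fun h => hi.1 (hu.mul_right_eq_zero.1 h), ?_⟩
  rw [w₂_val_two_mul hm]
  exact hi.2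

omit [NeZero r] in
theorem neg_mem_weightZeros_iff (hm : 2 ≤ m) (hS : ∀ s, s ∈ S ↔ (m : ZMod r) - s ∉ S)
    {i : ZMod (2 ^ m - 1)} (hi : i ≠ 0) : -i ∈ weightZeros r m S ↔ i ∉ weightZeros r m S := by
  have h := congrArg (Nat.cast (R := ZMod r)) (w₂_val_neg i hm hi)
  rw [Nat.cast_add, ← eq_sub_iff_add_eq] at h
  simp only [weightZeros, Set.mem_ofPred_eq, ne_eq, neg_eq_zero, hi, not_false_eq_true, true_and, h]
  rw [hS, sub_sub_cancel]

theorem mem_weightZeros_compl (hm : 2 ≤ m) (hS : ∀ s, s ∈ S ↔ (m : ZMod r) - s ∉ S)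
    (i : ZMod (2 ^ m - 1)) : i ∈ weightZeros r m Sᶜ ↔ -i ∈ weightZeros r m S := by
  by_cases hi : i = 0
  · simp [weightZeros, hi]
  · rw [neg_mem_weightZeros_iff hm hS hi]
    simp [weightZeros, hi]

theorem compl_symm (hS : ∀ s, s ∈ S ↔ (m : ZMod r) - s ∉ S) (s : ZMod r) :
    s ∈ Sᶜ ↔ (m : ZMod r) - s ∉ Sᶜ := by
  rw [Finset.mem_compl, Finset.mem_compl, hS s]

omit [NeZero r] in
theorem setOf_neg_notMem_weightZeros (hm : 2 ≤ m) (hS : ∀ s, s ∈ S ↔ (m : ZMod r) - s ∉ S) :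
    {i | -i ∉ weightZeros r m S} = {0} ∪ weightZeros r m S := by
  ext i
  by_cases hi : i = 0
  · simp [weightZeros, hi]
  · simp [neg_mem_weightZeros_iff hm hS hi, hi]

omit [NeZero r] in
theorem cyclotomicCoset_subset_weightZeros (hm : 2 ≤ m) {i : ZMod (2 ^ m - 1)}
    (hi : i ∈ weightZeros r m S) : cyclotomicCoset i ⊆ weightZeros r m S := by
  rintro _ ⟨t, rfl⟩
  induction t with
  | zero => simpa using hi
  | succ t ih =>
    rw [pow_succ, ← mul_assoc, mul_comm]
    exact two_mul_mem_weightZeros hm ih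

theorem isSplitting_weightZeros (hm : 2 ≤ m) (hS : ∀ s, s ∈ S ↔ (m : ZMod r) - s ∉ S) :
    IsSplitting (weightZeros r m S) (weightZeros r m Sᶜ) (-1) where
  coset_left _ := cyclotomicCoset_subset_weightZeros hm
  coset_right _ := cyclotomicCoset_subset_weightZeros hm
  union_eq := by
    ext i
    simp only [weightZeros, Set.mem_union, Set.mem_ofPred_eq, Finset.mem_compl, Set.mem_compl_iff,
      Set.mem_singleton_iff]
    tauto
  inter_eq := by
    ext i
    simp only [weightZeros, Set.mem_inter_iff, Set.mem_ofPred_eq, Finset.mem_compl,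
      Set.mem_empty_iff_false]
    tauto
  left_mul := by
    ext i
    rw [mem_weightZeros_compl hm hS]
    simp
  right_mul := by
    ext i
    simp [mem_weightZeros_compl hm hS]

/-! ### Zeros in arithmetic progression and the BCH bound -/

omit [NeZero r] in
theorem natCast_mul_mem_weightZeros {h i : ℕ} (hm : m = 2 * h + 1) (hh : 1 ≤ h)
    (hS : (h : ZMod r) ∈ S) (hi : 1 ≤ i) (hi' : i ≤ 2 ^ h) :
    ((2 ^ h - 1 : ℕ) : ZMod (2 ^ m - 1)) * i ∈ weightZeros r m S := by
  have h2 : 2 ≤ 2 ^ h := le_self_pow₀ (by norm_num) (by omega)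
  -- No reduction modulo `2 ^ m - 1` takes place, so the weight of the residue is that of the
  -- integer product.
  have hlt : i * (2 ^ h - 1) < 2 ^ m - 1 := by
    have h1 : i * (2 ^ h - 1) ≤ 2 ^ h * (2 ^ h - 1) := Nat.mul_le_mul_right _ hi'
    have h3 : 2 ^ m = 2 * (2 ^ h * 2 ^ h) := by rw [hm]; ring
    have h5 : 2 ^ h * (2 ^ h - 1) = 2 ^ h * 2 ^ h - 2 ^ h := Nat.mul_sub_one _ _
    have h4 : 2 ^ h ≤ 2 ^ h * 2 ^ h := Nat.le_mul_self _
    omega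
  have hpos : 0 < i * (2 ^ h - 1) := Nat.mul_pos hi (by omega)
  have hv : (((2 ^ h - 1 : ℕ) : ZMod (2 ^ m - 1)) * i).val = i * (2 ^ h - 1) := by
    rw [mul_comm, ← Nat.cast_mul, ZMod.val_cast_of_lt hlt]
  refine ⟨fun e => ?_, ?_⟩
  · rw [← ZMod.val_eq_zero, hv] at e
    omega
  · rw [hv, w₂_mul_two_pow_sub_one h i hi hi']
    exact hS

/-- The gcd is `2 ^ gcd(h, 2 * h + 1) - 1 = 1`. -/
theorem isUnit_two_pow_sub_one {h : ℕ} (hm : m = 2 * h + 1) :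
    IsUnit ((2 ^ h - 1 : ℕ) : ZMod (2 ^ m - 1)) := by
  rw [ZMod.isUnit_iff_coprime, Nat.Coprime, Nat.pow_sub_one_gcd_pow_sub_one, hm]
  simp

variable {K : Type*} [Field K] [Algebra (ZMod 2) K] {α : Kˣ} {h : ℕ}

theorem two_pow_lt_hammingNorm [NeZero (2 ^ m - 1)] (hα : orderOf α = 2 ^ m - 1)
    (hm : m = 2 * h + 1) (hh : 1 ≤ h) (hS : ∀ s, s ∈ S ↔ (m : ZMod r) - s ∉ S)
    {c : Fin (2 ^ m - 1) → ZMod 2} (hc : c ∈ zeroCode α (weightZeros r m S)) (hc0 : c ≠ 0) :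
    2 ^ h < hammingNorm c := by
  by_cases hS' : (h : ZMod r) ∈ S
  · exact lt_hammingNorm_of_mem_zeroCode hα hc hc0 (isUnit_two_pow_sub_one hm)
      fun i hi hi' => natCast_mul_mem_weightZeros hm hh hS' hi hi'
  -- If `h ∉ S`, the progression lies in the complementary zeros, and the step `-(2 ^ h - 1)` brings
  -- it back.
  · refine lt_hammingNorm_of_mem_zeroCode hα hc hc0 (isUnit_two_pow_sub_one hm).neg
      fun i hi hi' => ?_
    rw [neg_mul, ← mem_weightZeros_compl (by omega) hS]
    exact natCast_mul_mem_weightZeros hm hh (Finset.mem_compl.2 hS') hi hi'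

/-! ### Duality, dimensions and distances of the codes -/

section

variable [NeZero (2 ^ m - 1)]

omit [NeZero r] in
theorem cyclicCode_eq (hα : orderOf α = 2 ^ m - 1) :
    cyclicCode r m α S = zeroCode α (weightZeros r m S) := cyclicCode_eq_zeroCode hα rfl S

variable [Finite K]

omit [NeZero r] in
theorem dual_cyclicCode (hα : orderOf α = 2 ^ m - 1) (hm : 2 ≤ m)
    (hS : ∀ s, s ∈ S ↔ (m : ZMod r) - s ∉ S) :
    dual (cyclicCode r m α S) = zeroCode α ({0} ∪ weightZeros r m S) := by
  rw [cyclicCode_eq hα, dual_zeroCode hα (odd_two_pow_sub_one (by omega))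
    fun i => two_mul_mem_weightZeros hm, setOf_neg_notMem_weightZeros hm hS]

theorem mem_dual_cyclicCode (hα : orderOf α = 2 ^ m - 1) (hm : 2 ≤ m)
    (hS : ∀ s, s ∈ S ↔ (m : ZMod r) - s ∉ S) (c : Fin (2 ^ m - 1) → ZMod 2) :
    c ∈ dual (cyclicCode r m α S) ↔ c ∈ cyclicCode r m α S ∧ ∑ i, c i = 0 := by
  rw [dual_cyclicCode hα hm hS, cyclicCode_eq hα, mem_zeroCode_insert_zero]

omit [NeZero r] [Finite K] in
theorem one_mem_cyclicCode (hα : orderOf α = 2 ^ m - 1) : 1 ∈ cyclicCode r m α S := by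
  rw [cyclicCode_eq hα]
  exact one_mem_zeroCode hα fun h => h.1 rfl

theorem isSelfDual_extend_cyclicCode (hα : orderOf α = 2 ^ m - 1) (hm : 2 ≤ m)
    (hS : ∀ s, s ∈ S ↔ (m : ZMod r) - s ∉ S) : IsSelfDual (extend (cyclicCode r m α S)) :=
  isSelfDual_extend (odd_two_pow_sub_one (by omega)) (one_mem_cyclicCode hα)
    (mem_dual_cyclicCode hα hm hS)

theorem four_dvd_hammingNorm_of_mem_dual (hα : orderOf α = 2 ^ m - 1) (hm : 2 ≤ m)
    (hS : ∀ s, s ∈ S ↔ (m : ZMod r) - s ∉ S) {c : Fin (2 ^ m - 1) → ZMod 2}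
    (hc : c ∈ dual (cyclicCode r m α S)) : 4 ∣ hammingNorm c := by
  refine four_dvd_hammingNorm (odd_two_pow_sub_one (by omega)) (A := dual (cyclicCode r m α S))
    (fun d hd k => ?_) ?_ hc ((mem_dual_cyclicCode hα hm hS c).1 hc).2
  · rw [dual_cyclicCode hα hm hS] at hd ⊢
    exact comp_shift_mem_zeroCode hα k hd
  · rw [dual_dual]
    exact fun d hd => ((mem_dual_cyclicCode hα hm hS d).1 hd).1

theorem isDoublyEven_extend_cyclicCode (hα : orderOf α = 2 ^ m - 1) (hm : 2 ≤ m)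
    (hS : ∀ s, s ∈ S ↔ (m : ZMod r) - s ∉ S) : IsDoublyEven (extend (cyclicCode r m α S)) := by
  refine isDoublyEven_extend ?_ (one_mem_cyclicCode hα) fun c hc h0 =>
    four_dvd_hammingNorm_of_mem_dual hα hm hS ((mem_dual_cyclicCode hα hm hS c).2 ⟨hc, h0⟩)
  rw [Nat.sub_add_cancel Nat.one_le_two_pow]
  exact pow_dvd_pow 2 hm

theorem finrank_cyclicCode (hα : orderOf α = 2 ^ m - 1) (hm : 2 ≤ m)
    (hS : ∀ s, s ∈ S ↔ (m : ZMod r) - s ∉ S) :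
    Module.finrank (ZMod 2) (cyclicCode r m α S) = 2 ^ (m - 1) ∧
      Module.finrank (ZMod 2) (dual (cyclicCode r m α S)) = 2 ^ (m - 1) - 1 ∧
      Module.finrank (ZMod 2) (extend (cyclicCode r m α S)) = 2 ^ (m - 1) := by
  have h1 := finrank_eq_finrank_dual_add_one (odd_two_pow_sub_one (by omega))
    (one_mem_cyclicCode hα) (mem_dual_cyclicCode hα hm hS)
  have h2 := finrank_add_finrank_dual (cyclicCode r m α S)
  have h3 := two_mul_finrank_of_isSelfDual (isSelfDual_extend_cyclicCode hα hm hS)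
  have h4 : 2 ^ m = 2 * 2 ^ (m - 1) := by
    rw [← pow_succ', Nat.sub_add_cancel (by omega)]
  omega

/-- The weight exceeds `2 ^ h`, and both are multiples of `4` since `h ≥ 2`. -/
theorem le_hammingNorm_of_mem_extend (hα : orderOf α = 2 ^ m - 1) (hm : m = 2 * h + 1)
    (hh : 2 ≤ h) (hS : ∀ s, s ∈ S ↔ (m : ZMod r) - s ∉ S)
    {c : Fin (2 ^ m - 1 + 1) → ZMod 2} (hc : c ∈ extend (cyclicCode r m α S)) (hc0 : c ≠ 0) :
    2 ^ h + 4 ≤ hammingNorm c := by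
  have h4 := isDoublyEven_extend_cyclicCode hα (by omega) hS c hc
  rw [mem_extend, cyclicCode_eq hα, Fin.sum_univ_castSucc] at hc
  have hne : (fun i : Fin (2 ^ m - 1) => c i.castSucc) ≠ 0 := by
    intro e
    have e' (i : Fin (2 ^ m - 1)) : c i.castSucc = 0 := congrFun e i
    have hl := hc.2
    simp only [e', Finset.sum_const_zero, zero_add] at hl
    exact hc0 (funext fun i => Fin.lastCases hl e' i)
  have h1 := two_pow_lt_hammingNorm hα hm (by omega) hS hc.1 hne
  have h2 := hammingNorm_castSucc_add c
  have h3 : 4 ∣ 2 ^ h := pow_dvd_pow 2 hh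
  omega

/-- Appending the parity coordinate adds at most one to the weight. -/
theorem le_hammingNorm_of_mem_cyclicCode (hα : orderOf α = 2 ^ m - 1) (hm : m = 2 * h + 1)
    (hh : 2 ≤ h) (hS : ∀ s, s ∈ S ↔ (m : ZMod r) - s ∉ S)
    {c : Fin (2 ^ m - 1) → ZMod 2} (hc : c ∈ cyclicCode r m α S) (hc0 : c ≠ 0) :
    2 ^ h + 3 ≤ hammingNorm c := by
  let x : Fin (2 ^ m - 1 + 1) → ZMod 2 := Fin.snoc c (∑ i, c i)
  have hx (i : Fin (2 ^ m - 1)) : x i.castSucc = c i := by simp [x]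
  have h1 := le_hammingNorm_of_mem_extend hα hm hh hS (c := x) (by
    rw [mem_extend, Fin.sum_univ_castSucc]
    simp only [hx]
    exact ⟨hc, by simp [x, CharTwo.add_self_eq_zero]⟩) (by
    rintro e
    exact hc0 (funext fun i => by rw [← hx, e]; rfl))
  rw [hammingNorm_castSucc_add] at h1
  rw [show (fun i : Fin (2 ^ m - 1) => x i.castSucc) = c from funext hx] at h1
  split_ifs at h1 <;> omega

theorem le_hammingNorm_of_mem_dual_cyclicCode (hα : orderOf α = 2 ^ m - 1) (hm : m = 2 * h + 1)
    (hh : 2 ≤ h) (hS : ∀ s, s ∈ S ↔ (m : ZMod r) - s ∉ S)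
    {c : Fin (2 ^ m - 1) → ZMod 2} (hc : c ∈ dual (cyclicCode r m α S)) (hc0 : c ≠ 0) :
    2 ^ h + 4 ≤ hammingNorm c := by
  have h1 := le_hammingNorm_of_mem_cyclicCode hα hm hh hS
    ((mem_dual_cyclicCode hα (by omega) hS c).1 hc).1 hc0
  have h2 := four_dvd_hammingNorm_of_mem_dual hα (by omega) hS hc
  have h3 : 4 ∣ 2 ^ h := pow_dvd_pow 2 hh
  omega

theorem minDist_bounds (hα : orderOf α = 2 ^ m - 1) (hm : m = 2 * h + 1) (hh : 2 ≤ h)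
    (hS : ∀ s, s ∈ S ↔ (m : ZMod r) - s ∉ S) :
    2 ^ h + 3 ≤ minDist (cyclicCode r m α S) ∧
      2 ^ h + 4 ≤ minDist (dual (cyclicCode r m α S)) ∧
      2 ^ h + 4 ≤ minDist (extend (cyclicCode r m α S)) := by
  obtain ⟨h1, h2, h3⟩ := finrank_cyclicCode hα (by omega) hS
  have h4 : 2 ≤ 2 ^ (m - 1) := le_self_pow₀ (by norm_num) (by omega)
  exact ⟨le_minDist (exists_ne_zero_of_finrank_pos (by omega))
      fun c => le_hammingNorm_of_mem_cyclicCode hα hm hh hS,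
    le_minDist (exists_ne_zero_of_finrank_pos (by omega))
      fun c => le_hammingNorm_of_mem_dual_cyclicCode hα hm hh hS,
    le_minDist (exists_ne_zero_of_finrank_pos (by omega))
      fun c => le_hammingNorm_of_mem_extend hα hm hh hS⟩

/-- The permutation `x ↦ -x` of the coordinates carries each code to its counterpart for `Sᶜ`. -/
theorem minDist_compl (hα : orderOf α = 2 ^ m - 1) (hm : 2 ≤ m)
    (hS : ∀ s, s ∈ S ↔ (m : ZMod r) - s ∉ S) :
    minDist (cyclicCode r m α S) = minDist (cyclicCode r m α Sᶜ) ∧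
      minDist (dual (cyclicCode r m α S)) = minDist (dual (cyclicCode r m α Sᶜ)) ∧
      minDist (extend (cyclicCode r m α S)) = minDist (extend (cyclicCode r m α Sᶜ)) := by
  rw [dual_cyclicCode hα hm hS, dual_cyclicCode hα hm (compl_symm hS), cyclicCode_eq hα,
    cyclicCode_eq hα]
  have h1 := mem_zeroCode_iff_comp_neg hα (mem_weightZeros_compl hm hS)
  refine ⟨minDist_comap_perm _ h1, minDist_comap_perm _ (mem_zeroCode_iff_comp_neg hα fun i => ?_),
    minDist_extend_comap_perm _ h1⟩
  simp [mem_weightZeros_compl hm hS]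

omit [Finite K] in
theorem isOddLikeDuadicPair_cyclicCode (hα : orderOf α = 2 ^ m - 1) (hm : 2 ≤ m)
    (hS : ∀ s, s ∈ S ↔ (m : ZMod r) - s ∉ S) :
    IsOddLikeDuadicPair α (cyclicCode r m α S) (cyclicCode r m α Sᶜ) := by
  refine ⟨_, _, _, isSplitting_weightZeros hm hS, ?_, ?_⟩ <;>
  · rw [cyclicCode_eq hα]
    exact hasDefiningSet_zeroCode hα (odd_two_pow_sub_one (by omega))
      fun i => two_mul_mem_weightZeros hm

theorem isEvenLikeDuadicPair_dual_cyclicCode (hα : orderOf α = 2 ^ m - 1) (hm : 2 ≤ m)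
    (hS : ∀ s, s ∈ S ↔ (m : ZMod r) - s ∉ S) :
    IsEvenLikeDuadicPair α (dual (cyclicCode r m α S)) (dual (cyclicCode r m α Sᶜ)) := by
  have key (U : Finset (ZMod r)) : HasDefiningSet α (zeroCode α ({0} ∪ weightZeros r m U))
      ({0} ∪ weightZeros r m U) := by
    refine hasDefiningSet_zeroCode hα (odd_two_pow_sub_one (by omega)) ?_
    rintro i (hi | hi)
    · rw [Set.mem_singleton_iff.1 hi, mul_zero]
      exact Or.inl rfl
    · exact Or.inr (two_mul_mem_weightZeros hm hi)
  rw [dual_cyclicCode hα hm hS, dual_cyclicCode hα hm (compl_symm hS)]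
  exact ⟨_, _, _, isSplitting_weightZeros hm hS, key _, key _⟩

end

theorem duadic_codes_of_compl (hm : m = 2 * h + 1) (hh : 2 ≤ h) (hK : Nat.card K = 2 ^ m)
    (hα : ∀ x : Kˣ, x ∈ Subgroup.zpowers α) (hS : ∀ s, s ∈ S ↔ (m : ZMod r) - s ∉ S) :
    (IsOddLikeDuadicPair α (cyclicCode r m α S) (cyclicCode r m α Sᶜ) ∧
      ∃ d : ℕ, HasParameters (cyclicCode r m α S) (2 ^ m - 1) (2 ^ (m - 1)) d ∧
        HasParameters (cyclicCode r m α Sᶜ) (2 ^ m - 1) (2 ^ (m - 1)) d ∧ 2 ^ h + 3 ≤ d) ∧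
    (IsEvenLikeDuadicPair α (dual (cyclicCode r m α S)) (dual (cyclicCode r m α Sᶜ)) ∧
      ∃ d : ℕ, HasParameters (dual (cyclicCode r m α S)) (2 ^ m - 1) (2 ^ (m - 1) - 1) d ∧
        HasParameters (dual (cyclicCode r m α Sᶜ)) (2 ^ m - 1) (2 ^ (m - 1) - 1) d ∧
        2 ^ h + 4 ≤ d) ∧
    ((∃ d : ℕ, HasParameters (extend (cyclicCode r m α S)) (2 ^ m) (2 ^ (m - 1)) d ∧
        HasParameters (extend (cyclicCode r m α Sᶜ)) (2 ^ m) (2 ^ (m - 1)) d ∧ 2 ^ h + 4 ≤ d) ∧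
      IsSelfDual (extend (cyclicCode r m α S)) ∧ IsSelfDual (extend (cyclicCode r m α Sᶜ)) ∧
      IsDoublyEven (extend (cyclicCode r m α S)) ∧
      IsDoublyEven (extend (cyclicCode r m α Sᶜ))) := by
  have hm2 : 2 ≤ m := by omega
  have h4 : 2 ^ 2 ≤ 2 ^ m := Nat.pow_le_pow_right (by norm_num) hm2
  have : NeZero (2 ^ m - 1) := ⟨by omega⟩
  have : Finite K := Nat.finite_of_card_ne_zero (by omega)
  have ho : orderOf α = 2 ^ m - 1 := by
    rw [orderOf_eq_card_of_forall_mem_zpowers hα, Nat.card_units, hK]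
  have hS' := compl_symm hS
  obtain ⟨f1, f2, f3⟩ := finrank_cyclicCode ho hm2 hS
  obtain ⟨g1, g2, g3⟩ := finrank_cyclicCode ho hm2 hS'
  obtain ⟨d1, d2, d3⟩ := minDist_compl ho hm2 hS
  obtain ⟨b1, b2, b3⟩ := minDist_bounds ho hm hh hS
  have hn : 2 ^ m - 1 + 1 = 2 ^ m := by omega
  exact ⟨⟨isOddLikeDuadicPair_cyclicCode ho hm2 hS,
      _, ⟨rfl, f1, rfl⟩, ⟨rfl, g1, d1.symm⟩, b1⟩,
    ⟨isEvenLikeDuadicPair_dual_cyclicCode ho hm2 hS,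
      _, ⟨rfl, f2, rfl⟩, ⟨rfl, g2, d2.symm⟩, b2⟩,
    ⟨_, ⟨hn, f3, rfl⟩, ⟨hn, g3, d3.symm⟩, b3⟩,
    isSelfDual_extend_cyclicCode ho hm2 hS, isSelfDual_extend_cyclicCode ho hm2 hS',
    isDoublyEven_extend_cyclicCode ho hm2 hS, isDoublyEven_extend_cyclicCode ho hm2 hS'⟩

end

end

end BinaryCode

end

/-! ### The six sets modulo `8` -/

theorem theorem10 (m : ℕ) (hm9 : 9 ≤ m) (hm : m ≡ 1 [MOD 8])
    {K : Type*} [Field K] [Algebra (ZMod 2) K] (hK : Nat.card K = 2 ^ m)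
    (α : Kˣ) (hα : ∀ x : Kˣ, x ∈ Subgroup.zpowers α) :
    (∀ S : Finset (ZMod 8), (S = {0, 2, 3, 4} ∨ S = {0, 4, 6, 7}) →
      (BinaryCode.IsOddLikeDuadicPair α
          (BinaryCode.cyclicCode 8 m α S) (BinaryCode.cyclicCode 8 m α Sᶜ) ∧
        ∃ d : ℕ,
          BinaryCode.HasParameters (BinaryCode.cyclicCode 8 m α S)
            (2 ^ m - 1) (2 ^ (m - 1)) d ∧
          BinaryCode.HasParameters (BinaryCode.cyclicCode 8 m α Sᶜ)
            (2 ^ m - 1) (2 ^ (m - 1)) d ∧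
          2 ^ ((m - 1) / 2) + 3 ≤ d) ∧
      (BinaryCode.IsEvenLikeDuadicPair α
          (BinaryCode.dual (BinaryCode.cyclicCode 8 m α S))
          (BinaryCode.dual (BinaryCode.cyclicCode 8 m α Sᶜ)) ∧
        ∃ d : ℕ,
          BinaryCode.HasParameters (BinaryCode.dual (BinaryCode.cyclicCode 8 m α S))
            (2 ^ m - 1) (2 ^ (m - 1) - 1) d ∧
          BinaryCode.HasParameters (BinaryCode.dual (BinaryCode.cyclicCode 8 m α Sᶜ))
            (2 ^ m - 1) (2 ^ (m - 1) - 1) d ∧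
          2 ^ ((m - 1) / 2) + 4 ≤ d) ∧
      ((∃ d : ℕ,
          BinaryCode.HasParameters (BinaryCode.extend (BinaryCode.cyclicCode 8 m α S))
            (2 ^ m) (2 ^ (m - 1)) d ∧
          BinaryCode.HasParameters (BinaryCode.extend (BinaryCode.cyclicCode 8 m α Sᶜ))
            (2 ^ m) (2 ^ (m - 1)) d ∧
          2 ^ ((m - 1) / 2) + 4 ≤ d) ∧
        BinaryCode.IsSelfDual (BinaryCode.extend (BinaryCode.cyclicCode 8 m α S)) ∧
        BinaryCode.IsSelfDual (BinaryCode.extend (BinaryCode.cyclicCode 8 m α Sᶜ)) ∧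
        BinaryCode.IsDoublyEven (BinaryCode.extend (BinaryCode.cyclicCode 8 m α S)) ∧
        BinaryCode.IsDoublyEven (BinaryCode.extend (BinaryCode.cyclicCode 8 m α Sᶜ)))) ∧
    (∀ S : Finset (ZMod 8),
      (S = {0, 2, 3, 5} ∨ S = {0, 2, 5, 6} ∨ S = {0, 3, 5, 7} ∨ S = {0, 5, 6, 7}) →
      (BinaryCode.IsOddLikeDuadicPair α
          (BinaryCode.cyclicCode 8 m α S) (BinaryCode.cyclicCode 8 m α Sᶜ) ∧
        ∃ d : ℕ,
          BinaryCode.HasParameters (BinaryCode.cyclicCode 8 m α S)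
            (2 ^ m - 1) (2 ^ (m - 1)) d ∧
          BinaryCode.HasParameters (BinaryCode.cyclicCode 8 m α Sᶜ)
            (2 ^ m - 1) (2 ^ (m - 1)) d ∧
          (m ≡ 9 [MOD 16] → 2 ^ ((m - 1) / 2) + 1 ≤ d) ∧
          (m ≡ 1 [MOD 16] → 2 ^ ((m - 1) / 2) + 3 ≤ d)) ∧
      (BinaryCode.IsEvenLikeDuadicPair α
          (BinaryCode.dual (BinaryCode.cyclicCode 8 m α S))
          (BinaryCode.dual (BinaryCode.cyclicCode 8 m α Sᶜ)) ∧
        ∃ d : ℕ,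
          BinaryCode.HasParameters (BinaryCode.dual (BinaryCode.cyclicCode 8 m α S))
            (2 ^ m - 1) (2 ^ (m - 1) - 1) d ∧
          BinaryCode.HasParameters (BinaryCode.dual (BinaryCode.cyclicCode 8 m α Sᶜ))
            (2 ^ m - 1) (2 ^ (m - 1) - 1) d ∧
          (m ≡ 9 [MOD 16] → 2 ^ ((m - 1) / 2) + 2 ≤ d) ∧
          (m ≡ 1 [MOD 16] → 2 ^ ((m - 1) / 2) + 4 ≤ d)) ∧
      ((∃ d : ℕ,
          BinaryCode.HasParameters (BinaryCode.extend (BinaryCode.cyclicCode 8 m α S))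
            (2 ^ m) (2 ^ (m - 1)) d ∧
          BinaryCode.HasParameters (BinaryCode.extend (BinaryCode.cyclicCode 8 m α Sᶜ))
            (2 ^ m) (2 ^ (m - 1)) d ∧
          2 ^ ((m - 1) / 2) + 4 ≤ d) ∧
        BinaryCode.IsSelfDual (BinaryCode.extend (BinaryCode.cyclicCode 8 m α S)) ∧
        BinaryCode.IsSelfDual (BinaryCode.extend (BinaryCode.cyclicCode 8 m α Sᶜ)) ∧
        BinaryCode.IsDoublyEven (BinaryCode.extend (BinaryCode.cyclicCode 8 m α S)) ∧
        BinaryCode.IsDoublyEven (BinaryCode.extend (BinaryCode.cyclicCode 8 m α Sᶜ)))) := by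

  have hmr : (m : ZMod 8) = 1 := by
    simpa using (ZMod.natCast_eq_natCast_iff m 1 8).2 hm
  obtain ⟨h, hmh⟩ : ∃ h, m = 2 * h + 1 := ⟨m / 2, by rw [Nat.ModEq] at hm; omega⟩
  have hh : (m - 1) / 2 = h := by omega
  rw [hh]
  constructor
  · intro S hS
    refine BinaryCode.duadic_codes_of_compl hmh (by omega) hK hα ?_
    -- As `m ≡ 1` modulo `8`, the complementarity of `S` and `m - S` becomes a finite check of `s ∈
    -- S ↔ 1 - s ∉ S`.
    rw [hmr]
    rcases hS with rfl | rfl <;> decide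
  · intro S hS
    obtain ⟨⟨h1, d, p, q, b⟩, ⟨h2, d', p', q', b'⟩, h3⟩ :=
      BinaryCode.duadic_codes_of_compl (S := S) hmh (by omega) hK hα (by
        rw [hmr]
        rcases hS with rfl | rfl | rfl | rfl <;> decide)
    -- The stronger bounds hold for both residues modulo `16`; for `9` they are merely weakened.
    exact ⟨⟨h1, d, p, q, fun _ => by omega, fun _ => b⟩,
      ⟨h2, d', p', q', fun _ => by omega, fun _ => b'⟩, h3⟩
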